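/- Let $m\ge 6$ be even and $t=m/2$. Let $E_1,\dots,E_\alpha$ be a partial spread of order $\alpha$ in $\mathbb F_2^m$, that is, $t$-dimensional subspaces of $\mathbb F_2^m$ with $E_i\cap E_j=\{0\}$ for all $i\ne j$, and let $f_i:\mathbb F_2^m\to\mathbb F_2$ be the Boolean function with support $E_i\setminus\{0\}$. Let $A,B\subseteq\{1,\dots,\alpha\}$ with $|A|=|B|=s$ and $|A\cap B|=1$, put $f=\sum_{i\in A}f_i$ and $g=\sum_{i\in B}f_i$, and let $$\mathcal C_{f,g}=\Big\{\big(u f(x)+r g(x)+v\cdot x\big)_{x\in\mathbb F_2^m\setminus\{0\}} : u,r\in\mathbb F_2,\ v\in\mathbb F_2^m\Big\}.$$ If $2\le s\le 2^{t-1}-1$, then $\mathcal C_{f,g}$ is a binary linear code of length $2^m-1$ and dimension $m+2$; it is minimal, i.e. the only nonzero codeword whose support is contained in the support of a given nonzero codeword $c$ is $c$ itself; and its weight distribution is given by the following table, in which the multiplicities of rows with equal weights are to be added (and all weights not listed have multiplicity $0$): $$\begin{array}{ll} \text{Weight} & \text{Multiplicity}\\ \hline 0 & 1\\ s(2^t-1)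 & 2\\ (2s-2)(2^t-1) & 1\\ 2^{m-1} & 2^m-1\\ 2^{m-1}-s & 2(2^t+1-s)(2^t-1)\\ 2^{m-1}-(2s-2) & (2^t+1-(2s-2))(2^t-1)\\ 2^{m-1}+2^t-s & 2s(2^t-1)\\ 2^{m-1}+2^t-(2s-2) & (2s-2)(2^t-1) \end{array}$$ If moreover $s\le 2^{t-2}$, then $w_{\min}/w_{\max}\le \tfrac12$, where $w_{\min}$ and $w_{\max}$ are the smallest and the largest Hamming weight of a nonzero codeword of $\mathcal C_{f,g}$. -/

import Mathlib

/-- The coordinate positions: the nonzero vectors of `𝔽₂ᵐ`. -/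
abbrev NonzeroVec (m : ℕ) : Type := {x : Fin m → ZMod 2 // x ≠ 0}

/-- The binary linear code `C_{f,g}` attached to two Boolean functions `f, g : 𝔽₂ᵐ → 𝔽₂`: all
vectors `(u f(x) + r g(x) + v · x)`, indexed by the nonzero `x`, for `u, r ∈ 𝔽₂` and `v ∈ 𝔽₂ᵐ`. -/
def codeOf {m : ℕ} (f g : (Fin m → ZMod 2) → ZMod 2) :
    Submodule (ZMod 2) (NonzeroVec m → ZMod 2) where
  carrier := {c | ∃ (u r : ZMod 2) (v : Fin m → ZMod 2),
    c = fun x => u * f x.1 + r * g x.1 + dotProduct v x.1}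
  zero_mem' := ⟨0, 0, 0, by ext x; simp⟩
  add_mem' := by
    rintro _ _ ⟨u, r, v, rfl⟩ ⟨u', r', v', rfl⟩
    refine ⟨u + u', r + r', v + v', ?_⟩
    ext x
    simp only [Pi.add_apply, add_dotProduct]
    ring
  smul_mem' := by
    rintro a _ ⟨u, r, v, rfl⟩
    refine ⟨a * u, a * r, a • v, ?_⟩
    ext x
    simp only [Pi.smul_apply, smul_eq_mul, smul_dotProduct]
    ring

/-- A linear code over `K` with coordinates indexed by `ι` is an `[n, k]` code if it has length `n`
and dimension `k`. -/
def IsLinearCode {K ι : Type*} [Field K] [Fintype ι] (C : Submodule K (ι → K)) (n k : ℕ) : Prop :=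
  Fintype.card ι = n ∧ Module.finrank K C = k

/-- A codeword `c` of `C` is minimal if the only nonzero codewords that it covers are its nonzero
scalar multiples. -/
def IsMinimalCodeword {K ι : Type*} [Field K] (C : Submodule K (ι → K)) (c : ι → K) : Prop :=
  c ∈ C ∧ ∀ c' ∈ C, c' ≠ 0 → Function.support c' ⊆ Function.support c →
    ∃ u : K, u ≠ 0 ∧ c' = u • c

/-- A linear code is minimal if each of its nonzero codewords is minimal. -/
def IsMinimalCode {K ι : Type*} [Field K] (C : Submodule K (ι → K)) : Prop :=
  ∀ c ∈ C, c ≠ 0 → IsMinimalCodeword C c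

/-- The number of codewords of Hamming weight `w`. -/
noncomputable def weightCount {K ι : Type*} [Field K] [DecidableEq K] [Fintype ι]
    (C : Submodule K (ι → K)) (w : ℕ) : ℕ :=
  {c : ι → K | c ∈ C ∧ hammingNorm c = w}.ncard

/-- `C` has the weight distribution given by a table of rows `(weight, multiplicity)`; the
multiplicities of rows with the same weight add up, and weights not listed do not occur. -/
def HasWeightTable {K ι : Type*} [Field K] [DecidableEq K] [Fintype ι]
    (C : Submodule K (ι → K)) (T : List (ℕ × ℕ)) : Prop :=
  ∀ w : ℕ, weightCount C w = ((T.filter (fun row => row.1 = w)).map Prod.snd).sum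

/-- The set of Hamming weights of the nonzero codewords. -/
def nonzeroWeights {K ι : Type*} [Field K] [DecidableEq K] [Fintype ι]
    (C : Submodule K (ι → K)) : Set ℕ :=
  {w | ∃ c ∈ C, c ≠ 0 ∧ hammingNorm c = w}

/-- A partial spread of order `α` in `𝔽₂ᵐ`, `m = 2t`: subspaces `E₁, …, E_α` of dimension `t` that
pairwise meet only in `0`. -/
def IsPartialSpread {m α : ℕ} (t : ℕ) (E : Fin α → Submodule (ZMod 2) (Fin m → ZMod 2)) : Prop :=
  m = 2 * t ∧ (∀ i, Module.finrank (ZMod 2) (E i) = t) ∧ ∀ i j, i ≠ j → E i ⊓ E j = ⊥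

open Classical in
/-- The Boolean function with support `E ∖ {0}`. -/
noncomputable def puncturedIndicator {m : ℕ} (E : Submodule (ZMod 2) (Fin m → ZMod 2)) :
    (Fin m → ZMod 2) → ZMod 2 :=
  fun x => if x ∈ E ∧ x ≠ 0 then 1 else 0

/-- The sum over `i ∈ A` of the Boolean functions with supports `E i ∖ {0}`. -/
noncomputable def spreadFunction {m α : ℕ} (E : Fin α → Submodule (ZMod 2) (Fin m → ZMod 2))
    (A : Finset (Fin α)) : (Fin m → ZMod 2) → ZMod 2 :=
  ∑ i ∈ A, puncturedIndicator (E i)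

/-! Everything rests on one weight formula. Off `0` the spaces `E i` are disjoint, so `u f + r g` is
the indicator of the union of the punctured spaces with index in a set `D`, which is `∅`, `A`, `B`
or `symmDiff A B`, of size `0`, `s`, `s` or `2s - 2`. A sum of signs `(-1)^(v·x)` over `E i` is
`2^t` if `v ⊥ E i` and `0` otherwise, so the word of `D` and `v` has weight `[v ≠ 0] 2^(m-1) + 2^t N
- |D|`, where `N` counts the `i ∈ D` with `v ⊥ E i` (`hammingNorm_spreadWord`).

Any two distinct `E i` span the space, so their orthogonal complements meet only in `0`. Hence `N ≤
1` for `v ≠ 0`, with equality for exactly `|D| (2^t - 1)` vectors; this gives the table.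

For minimality, a word `c` covering `c'` satisfies `wt c = wt c' + wt (c + c')`. Bounds on the
weights, separately for `v = 0` and `v ≠ 0`, exclude this unless `c' = c` or `c' = 0`. -/

/-- The nontrivial additive character of `𝔽₂`. -/
def signChar : AddChar (ZMod 2) ℤ where
  toFun a := if a = 0 then 1 else -1
  map_zero_eq_one' := by simp
  map_add_eq_mul' := by decide

lemma signChar_eq_sub (a : ZMod 2) : signChar a = 1 - 2 * (if a ≠ 0 then 1 else 0) := by
  revert a; decide

lemma signChar_eq_one_iff (a : ZMod 2) : signChar a = 1 ↔ a = 0 := by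
  revert a; decide

open Classical in
lemma sum_signChar_linear {V : Type*} [AddCommGroup V] [Module (ZMod 2) V] [Fintype V]
    (φ : V →ₗ[ZMod 2] ZMod 2) :
    ∑ x, signChar (φ x) = if φ = 0 then (Fintype.card V : ℤ) else 0 := by
  split_ifs with h
  · simp [h]
  · have hne : signChar.compAddMonoidHom φ.toAddMonoidHom ≠ 1 := by
      intro h1
      apply h
      ext x
      have := DFunLike.congr_fun h1 x
      simpa [signChar_eq_one_iff] using this
    simpa using AddChar.sum_eq_zero_of_ne_one hne

/-! ### Orthogonal complements and character sums over subspaces -/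

section Perp

variable {m : ℕ}

/-- The orthogonal complement with respect to the standard dot product. -/
def dotPerp (E : Submodule (ZMod 2) (Fin m → ZMod 2)) :
    Submodule (ZMod 2) (Fin m → ZMod 2) where
  carrier := {v | ∀ x ∈ E, dotProduct v x = 0}
  zero_mem' := by simp
  add_mem' := by
    intro a b ha hb x hx
    rw [add_dotProduct, ha x hx, hb x hx, add_zero]
  smul_mem' := by
    intro c a ha x hx
    rw [smul_dotProduct, ha x hx, smul_zero]

lemma mem_dotPerp {E : Submodule (ZMod 2) (Fin m → ZMod 2)} {v : Fin m → ZMod 2} :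
    v ∈ dotPerp E ↔ ∀ x ∈ E, dotProduct v x = 0 := Iff.rfl

lemma dotPerp_disjoint {E F : Submodule (ZMod 2) (Fin m → ZMod 2)} (h : E ⊔ F = ⊤)
    {v : Fin m → ZMod 2} (hE : v ∈ dotPerp E) (hF : v ∈ dotPerp F) : v = 0 := by
  apply dotProduct_eq_zero
  intro x
  obtain ⟨y, hy, z, hz, rfl⟩ := Submodule.mem_sup.1 (h ▸ Submodule.mem_top : x ∈ E ⊔ F)
  rw [dotProduct_add, hE y hy, hF z hz, add_zero]

open Classical in
lemma sum_signChar_submodule (E : Submodule (ZMod 2) (Fin m → ZMod 2)) (v : Fin m → ZMod 2) :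
    ∑ x with x ∈ E, signChar (dotProduct v x) =
      if v ∈ dotPerp E then (2 : ℤ) ^ Module.finrank (ZMod 2) E else 0 := by
  rw [Finset.sum_subtype (p := fun x => x ∈ E) _ (by simp)]
  have h := sum_signChar_linear ((dotProductBilin (ZMod 2) (ZMod 2) v) ∘ₗ E.subtype)
  have hc : (Fintype.card E : ℤ) = 2 ^ Module.finrank (ZMod 2) E := by
    rw [Module.card_eq_pow_finrank (K := ZMod 2)]; simp
  have hz : ((dotProductBilin (ZMod 2) (ZMod 2) v) ∘ₗ E.subtype = 0) ↔ v ∈ dotPerp E := by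
    simp [mem_dotPerp, LinearMap.ext_iff]
  rw [hc] at h
  simp only [hz] at h
  exact h

lemma sum_signChar_dotProduct (v : Fin m → ZMod 2) :
    ∑ x, signChar (dotProduct v x) = if v = 0 then (2 : ℤ) ^ m else 0 := by
  have h := sum_signChar_submodule ⊤ v
  have hz : v ∈ dotPerp ⊤ ↔ v = 0 := by
    simp [mem_dotPerp, dotProduct_eq_zero_iff]
  simpa [hz] using h

-- Double counting: summing over all `v` first leaves only `x = 0`, summing over `x ∈ E` first
-- leaves only `v ∈ dotPerp E`.
open Classical in
lemma card_dotPerp (E : Submodule (ZMod 2) (Fin m → ZMod 2)) :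
    2 ^ Module.finrank (ZMod 2) E * (Finset.univ.filter (· ∈ dotPerp E)).card = 2 ^ m := by
  have h : ∑ v, ∑ x with x ∈ E, signChar (dotProduct v x) = 2 ^ m := by
    rw [Finset.sum_comm]
    simp_rw [fun v x : Fin m → ZMod 2 => dotProduct_comm v x, sum_signChar_dotProduct]
    simp
  simp_rw [sum_signChar_submodule] at h
  rw [← Finset.sum_filter, Finset.sum_const, nsmul_eq_mul, mul_comm] at h
  exact_mod_cast h

end Perp

/-! ### Partial spreads and the weight formula -/

section Spread

variable {m α t : ℕ} {E : Fin α → Submodule (ZMod 2) (Fin m → ZMod 2)}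

lemma IsPartialSpread.two_pow_eq (hE : IsPartialSpread t E) : 2 ^ m = 2 ^ t * 2 ^ t := by
  rw [← pow_add, ← two_mul, ← hE.1]

lemma IsPartialSpread.eq_of_mem (hE : IsPartialSpread t E) {i j : Fin α} {x : Fin m → ZMod 2}
    (hx : x ≠ 0) (hi : x ∈ E i) (hj : x ∈ E j) : i = j := by
  by_contra hij
  have : x ∈ E i ⊓ E j := ⟨hi, hj⟩
  rw [hE.2.2 i j hij] at this
  exact hx (by simpa using this)

/-- Since `t + t = m`, two distinct members span the space, and only `0` is orthogonal to both. -/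
lemma IsPartialSpread.eq_of_mem_dotPerp (hE : IsPartialSpread t E) {i j : Fin α}
    {v : Fin m → ZMod 2} (hv : v ≠ 0) (hi : v ∈ dotPerp (E i)) (hj : v ∈ dotPerp (E j)) :
    i = j := by
  by_contra hij
  refine hv (dotPerp_disjoint (Submodule.eq_top_of_disjoint _ _ ?_ ?_) hi hj)
  · rw [hE.2.1, hE.2.1, Module.finrank_fin_fun, hE.1]; omega
  · rw [disjoint_iff, hE.2.2 i j hij]

open Classical in
lemma IsPartialSpread.card_dotPerp_inter_ne_zero (hE : IsPartialSpread t E) (i : Fin α) :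
    (Finset.univ.filter fun v => v ∈ dotPerp (E i) ∧ v ≠ 0).card = 2 ^ t - 1 := by
  have h := card_dotPerp (E i)
  rw [hE.2.1, hE.two_pow_eq] at h
  have h' := Nat.eq_of_mul_eq_mul_left (by positivity) h
  rw [← Finset.filter_filter, Finset.filter_ne', Finset.card_erase_of_mem (by simp), h']

/-- The number of `i ∈ D` for which `v` is orthogonal to `E i`. -/
noncomputable def perpCount (E : Fin α → Submodule (ZMod 2) (Fin m → ZMod 2))
    (D : Finset (Fin α)) (v : Fin m → ZMod 2) : ℕ :=
  open Classical in (D.filter fun i => v ∈ dotPerp (E i)).card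

lemma perpCount_zero (D : Finset (Fin α)) : perpCount E D 0 = D.card := by
  simp [perpCount, zero_mem]

lemma IsPartialSpread.perpCount_le_one (hE : IsPartialSpread t E) (D : Finset (Fin α))
    {v : Fin m → ZMod 2} (hv : v ≠ 0) : perpCount E D v ≤ 1 := by
  classical
  refine Finset.card_le_one.2 fun i hi j hj => ?_
  rw [Finset.mem_filter] at hi hj
  exact hE.eq_of_mem_dotPerp hv hi.2 hj.2

lemma IsPartialSpread.card_perpCount_eq_one (hE : IsPartialSpread t E) (D : Finset (Fin α)) :
    (Finset.univ.filter fun v => v ≠ 0 ∧ perpCount E D v = 1).card = D.card * (2 ^ t - 1) := by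
  classical
  have h : (Finset.univ.filter fun v => v ≠ 0 ∧ perpCount E D v = 1) =
      D.biUnion fun i => Finset.univ.filter fun v => v ∈ dotPerp (E i) ∧ v ≠ 0 := by
    ext v
    simp only [Finset.mem_filter, Finset.mem_univ, true_and, Finset.mem_biUnion]
    constructor
    · rintro ⟨hv, h⟩
      obtain ⟨i, hi⟩ := Finset.card_eq_one.1 h
      have hi' := Finset.mem_filter.1 (hi ▸ Finset.mem_singleton_self i)
      exact ⟨i, hi'.1, hi'.2, hv⟩
    · rintro ⟨i, hi, hvi, hv⟩
      refine ⟨hv, le_antisymm (hE.perpCount_le_one D hv) ?_⟩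
      exact Finset.card_pos.2 ⟨i, Finset.mem_filter.2 ⟨hi, hvi⟩⟩
  rw [h, Finset.card_biUnion]
  · simp [hE.card_dotPerp_inter_ne_zero]
  · intro i _ j _ hij
    refine Finset.disjoint_left.2 fun v hv hv' => ?_
    simp only [Finset.mem_filter, Finset.mem_univ, true_and] at hv hv'
    exact hij (hE.eq_of_mem_dotPerp hv.2 hv.1 hv'.1)

lemma IsPartialSpread.card_perpCount_eq_zero (hE : IsPartialSpread t E) (D : Finset (Fin α))
    (hD : D.card ≤ 2 ^ t + 1) :
    (Finset.univ.filter fun v => v ≠ 0 ∧ perpCount E D v = 0).card =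
      (2 ^ t + 1 - D.card) * (2 ^ t - 1) := by
  classical
  have h1 := hE.card_perpCount_eq_one D
  have hsum : (Finset.univ.filter fun v : Fin m → ZMod 2 => v ≠ 0 ∧ perpCount E D v = 0).card +
      (Finset.univ.filter fun v => v ≠ 0 ∧ perpCount E D v = 1).card = 2 ^ m - 1 := by
    rw [← Finset.card_union_of_disjoint]
    · have : (Finset.univ.filter fun v : Fin m → ZMod 2 => v ≠ 0 ∧ perpCount E D v = 0) ∪
          (Finset.univ.filter fun v => v ≠ 0 ∧ perpCount E D v = 1) = Finset.univ.erase 0 := by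
        ext v
        simp only [Finset.mem_union, Finset.mem_filter, Finset.mem_univ, true_and,
          Finset.mem_erase, and_true]
        constructor
        · rintro (h | h) <;> exact h.1
        · intro hv
          have := hE.perpCount_le_one D hv
          simp only [hv, ne_eq, not_false_eq_true, true_and]
          omega
      rw [this, Finset.card_erase_of_mem (Finset.mem_univ _)]
      simp
    · rw [Finset.disjoint_left]
      intro v hv hv'
      simp only [Finset.mem_filter] at hv hv'
      omega
  rw [h1, hE.two_pow_eq] at hsum
  have hq : 1 ≤ 2 ^ t := Nat.one_le_two_pow
  obtain ⟨p, hp⟩ := Nat.exists_eq_add_of_le hq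
  obtain ⟨k, hk⟩ := Nat.exists_eq_add_of_le hD
  rw [hk, Nat.add_sub_cancel_left]
  rw [hp] at hsum hk ⊢
  -- With `2^t = 1 + p` this is `2^m - 1 = (2^t + 1)(2^t - 1)`, from which `|D| (2^t - 1)` is taken
  -- away.
  have e : (1 + p) * (1 + p) - 1 = (1 + p + 1) * p := by
    rw [show (1 + p) * (1 + p) = (1 + p + 1) * p + 1 by ring]; rfl
  rw [e, hk, Nat.add_sub_cancel_left, add_mul, add_comm] at hsum
  rw [Nat.add_sub_cancel_left]
  exact Nat.add_left_cancel hsum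

lemma spreadFunction_zero (D : Finset (Fin α)) : spreadFunction E D 0 = 0 := by
  simp [spreadFunction, puncturedIndicator]

-- A nonzero `x` lies in at most one `E i`, so the sum mod 2 agrees with the integer sum of
-- indicators; the term for `x = 0` punctures each space.
open Classical in
lemma IsPartialSpread.signChar_spreadFunction (hE : IsPartialSpread t E) (D : Finset (Fin α))
    (x : Fin m → ZMod 2) :
    signChar (spreadFunction E D x) =
      1 - 2 * ∑ i ∈ D, ((if x ∈ E i then 1 else 0) - (if x = 0 then 1 else 0) : ℤ) := by
  rw [signChar_eq_sub]
  congr 2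
  rcases eq_or_ne x 0 with rfl | hx
  · simp [spreadFunction_zero, zero_mem]
  · simp only [spreadFunction, Finset.sum_apply, puncturedIndicator, hx, ne_eq,
      not_false_eq_true, and_true, if_false, sub_zero]
    by_cases h : ∃ i ∈ D, x ∈ E i
    · obtain ⟨i, hi, hxi⟩ := h
      have hne : ∀ j ∈ D, j ≠ i → x ∉ E j := fun j _ hj hxj => hj (hE.eq_of_mem hx hxj hxi)
      rw [Finset.sum_eq_single_of_mem i hi (fun j hj hji => if_neg (hne j hj hji)),
        Finset.sum_eq_single_of_mem i hi (fun j hj hji => if_neg (hne j hj hji))]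
      simp [hxi]
    · push Not at h
      rw [Finset.sum_eq_zero (fun j hj => if_neg (h j hj)),
        Finset.sum_eq_zero (fun j hj => if_neg (h j hj))]
      simp

/-- Omitting the coordinate `0` loses no weight because `h` vanishes there. -/
lemma sum_signChar_eq_sub_hammingNorm (h : (Fin m → ZMod 2) → ZMod 2) (h0 : h 0 = 0) :
    ∑ x, signChar (h x) = 2 ^ m - 2 * (hammingNorm fun x : NonzeroVec m => h x.1 : ℤ) := by
  classical
  have hc : (hammingNorm fun x : NonzeroVec m => h x.1) =
      (Finset.univ.filter fun x => h x ≠ 0).card := by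
    unfold hammingNorm
    refine Finset.card_bij (fun x _ => x.1) (by simp) (fun a _ b _ => Subtype.ext) ?_
    intro b hb
    have hb' := (Finset.mem_filter.1 hb).2
    exact ⟨⟨b, fun hb0 => hb' (hb0 ▸ h0)⟩, by simpa using hb', rfl⟩
  simp_rw [signChar_eq_sub]
  rw [Finset.sum_sub_distrib, ← Finset.mul_sum, Finset.sum_boole, hc]
  simp

/-- The codeword attached to the union of the punctured spaces indexed by `D` and to `v`. -/
noncomputable def spreadWord (E : Fin α → Submodule (ZMod 2) (Fin m → ZMod 2))
    (D : Finset (Fin α)) (v : Fin m → ZMod 2) : NonzeroVec m → ZMod 2 :=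
  fun x => spreadFunction E D x.1 + dotProduct v x.1

lemma IsPartialSpread.hammingNorm_spreadWord (hE : IsPartialSpread t E) (hm : 1 ≤ m)
    (D : Finset (Fin α)) (v : Fin m → ZMod 2) :
    (hammingNorm (spreadWord E D v) : ℤ) =
      (if v = 0 then 0 else 2 ^ (m - 1)) + 2 ^ t * perpCount E D v - D.card := by
  classical
  have h := sum_signChar_eq_sub_hammingNorm (fun x => spreadFunction E D x + dotProduct v x)
    (by simp [spreadFunction_zero])
  have hs : ∑ x, signChar (spreadFunction E D x + dotProduct v x) =
      (if v = 0 then (2 : ℤ) ^ m else 0) - 2 * (2 ^ t * perpCount E D v - D.card) := by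
    simp_rw [AddChar.map_add_eq_mul, hE.signChar_spreadFunction, sub_mul, one_mul, mul_assoc,
      Finset.sum_mul]
    rw [Finset.sum_sub_distrib, sum_signChar_dotProduct, ← Finset.mul_sum, Finset.sum_comm]
    congr 2
    have : ∀ i, ∑ x, (((if x ∈ E i then 1 else 0) - (if x = 0 then 1 else 0) : ℤ) *
        signChar (dotProduct v x)) = (if v ∈ dotPerp (E i) then (2 : ℤ) ^ t else 0) - 1 := by
      intro i
      simp_rw [sub_mul, Finset.sum_sub_distrib, ite_mul, one_mul, zero_mul]
      rw [← Finset.sum_filter, sum_signChar_submodule, hE.2.1]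
      simp
    simp_rw [this, Finset.sum_sub_distrib, ← Finset.sum_filter, Finset.sum_const, perpCount]
    simp [mul_comm]
  rw [hs] at h
  change _ = 2 ^ m - 2 * (hammingNorm (spreadWord E D v) : ℤ) at h
  have hp : (2 : ℤ) ^ m = 2 * 2 ^ (m - 1) := by rw [← pow_succ', Nat.sub_add_cancel hm]
  rw [hp] at h
  split_ifs at h ⊢ <;> linarith

end Spread

lemma ZMod.eq_zero_or_eq_one (a : ZMod 2) : a = 0 ∨ a = 1 := by
  revert a; decide

section Spread

variable {m α t : ℕ} {E : Fin α → Submodule (ZMod 2) (Fin m → ZMod 2)}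

lemma IsPartialSpread.hammingNorm_spreadWord_zero (hE : IsPartialSpread t E) (hm : 1 ≤ m)
    (D : Finset (Fin α)) : hammingNorm (spreadWord E D 0) = D.card * (2 ^ t - 1) := by
  have h := hE.hammingNorm_spreadWord hm D 0
  rw [if_pos rfl, perpCount_zero] at h
  zify [Nat.one_le_two_pow (n := t)]
  rw [h]; ring

lemma IsPartialSpread.hammingNorm_spreadWord_of_perpCount_eq_zero (hE : IsPartialSpread t E)
    (hm : 1 ≤ m) {D : Finset (Fin α)} {v : Fin m → ZMod 2} (hv : v ≠ 0)
    (h0 : perpCount E D v = 0) : hammingNorm (spreadWord E D v) = 2 ^ (m - 1) - D.card := by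
  have h := hE.hammingNorm_spreadWord hm D v
  rw [if_neg hv, h0] at h
  -- The additive form also shows that the natural subtraction does not truncate.
  have h' : hammingNorm (spreadWord E D v) + D.card = 2 ^ (m - 1) := by
    zify; rw [h]; push_cast; ring
  omega

lemma IsPartialSpread.hammingNorm_spreadWord_of_perpCount_eq_one (hE : IsPartialSpread t E)
    (hm : 1 ≤ m) {D : Finset (Fin α)} {v : Fin m → ZMod 2} (hv : v ≠ 0)
    (h1 : perpCount E D v = 1) :
    hammingNorm (spreadWord E D v) = 2 ^ (m - 1) + 2 ^ t - D.card := by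
  have h := hE.hammingNorm_spreadWord hm D v
  rw [if_neg hv, h1] at h
  have h' : hammingNorm (spreadWord E D v) + D.card = 2 ^ (m - 1) + 2 ^ t := by
    zify; rw [h]; push_cast; ring
  omega

lemma IsPartialSpread.card_hammingNorm_spreadWord_eq (hE : IsPartialSpread t E) (hm : 1 ≤ m)
    (D : Finset (Fin α)) (hD : D.card ≤ 2 ^ t + 1) (w : ℕ) :
    (Finset.univ.filter fun v => hammingNorm (spreadWord E D v) = w).card =
      (if D.card * (2 ^ t - 1) = w then 1 else 0) +
      ((2 ^ t + 1 - D.card) * (2 ^ t - 1)) * (if 2 ^ (m - 1) - D.card = w then 1 else 0) +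
      (D.card * (2 ^ t - 1)) * (if 2 ^ (m - 1) + 2 ^ t - D.card = w then 1 else 0) := by
  classical
  have key : ∀ v, (if hammingNorm (spreadWord E D v) = w then 1 else 0) =
      (if v = 0 then (if D.card * (2 ^ t - 1) = w then 1 else 0) else 0) +
      (if v ≠ 0 ∧ perpCount E D v = 0 then
        (if 2 ^ (m - 1) - D.card = w then 1 else 0) else 0) +
      (if v ≠ 0 ∧ perpCount E D v = 1 then
        (if 2 ^ (m - 1) + 2 ^ t - D.card = w then 1 else 0) else 0) := by
    intro v
    rcases eq_or_ne v 0 with rfl | hv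
    · simp [hE.hammingNorm_spreadWord_zero hm]
    · rcases Nat.le_one_iff_eq_zero_or_eq_one.1 (hE.perpCount_le_one D hv) with h | h
      · simp [hE.hammingNorm_spreadWord_of_perpCount_eq_zero hm hv h, hv, h]
      · simp [hE.hammingNorm_spreadWord_of_perpCount_eq_one hm hv h, hv, h]
  rw [Finset.card_filter, Finset.sum_congr rfl fun v _ => key v, Finset.sum_add_distrib,
    Finset.sum_add_distrib, ← hE.card_perpCount_eq_zero D hD, ← hE.card_perpCount_eq_one D]
  congr 1
  · congr 1
    · simp
    · rw [← Finset.sum_filter, Finset.sum_const, smul_eq_mul]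
  · rw [← Finset.sum_filter, Finset.sum_const, smul_eq_mul]

/-! ### Codewords as spread words -/

/-- The index set of the spaces occurring in `u f + r g`, for `d = (u, r)`. -/
def selectIndices (A B : Finset (Fin α)) (d : ZMod 2 × ZMod 2) : Finset (Fin α) :=
  symmDiff (if d.1 = 0 then ∅ else A) (if d.2 = 0 then ∅ else B)

/-- Spaces indexed by `A ∩ B` occur twice and cancel in characteristic 2. -/
lemma spreadFunction_symmDiff (A B : Finset (Fin α)) :
    spreadFunction E (symmDiff A B) = spreadFunction E A + spreadFunction E B := by
  have hd : Disjoint (A \ B) (B \ A) := disjoint_sdiff_sdiff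
  have h2 : ∀ F : (Fin m → ZMod 2) → ZMod 2, F + F = 0 := fun F => by
    ext x; exact CharTwo.add_self_eq_zero _
  unfold spreadFunction
  rw [symmDiff, Finset.sup_eq_union, Finset.sum_union hd,
    ← Finset.sum_inter_add_sum_sdiff A B, ← Finset.sum_inter_add_sum_sdiff B A,
    Finset.inter_comm B A, add_add_add_comm, h2, zero_add]

lemma spreadFunction_selectIndices (A B : Finset (Fin α)) (d : ZMod 2 × ZMod 2)
    (x : Fin m → ZMod 2) :
    spreadFunction E (selectIndices A B d) x =
      d.1 * spreadFunction E A x + d.2 * spreadFunction E B x := by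
  have h : ∀ (u : ZMod 2) (D : Finset (Fin α)),
      spreadFunction E (if u = 0 then ∅ else D) x = u * spreadFunction E D x := by
    intro u D
    rcases ZMod.eq_zero_or_eq_one u with rfl | rfl <;> simp [spreadFunction]
  rw [selectIndices, spreadFunction_symmDiff, Pi.add_apply, h, h]

lemma card_selectIndices {A B : Finset (Fin α)} {s : ℕ} (hA : A.card = s) (hB : B.card = s)
    (hAB : (A ∩ B).card = 1) (d : ZMod 2 × ZMod 2) :
    (selectIndices A B d).card =
      if d = (0, 0) then 0 else if d = (1, 1) then 2 * s - 2 else s := by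
  have h1 := Finset.card_sdiff_add_card_inter A B
  have h2 := Finset.card_sdiff_add_card_inter B A
  rw [Finset.inter_comm B A] at h2
  have h3 : (symmDiff A B).card = 2 * s - 2 := by
    rw [symmDiff, Finset.sup_eq_union, Finset.card_union_of_disjoint disjoint_sdiff_sdiff]
    omega
  have h4 : symmDiff ∅ B = B := bot_symmDiff B
  have h5 : symmDiff A ∅ = A := symmDiff_bot A
  obtain ⟨u, r⟩ := d
  rcases ZMod.eq_zero_or_eq_one u with rfl | rfl <;>
    rcases ZMod.eq_zero_or_eq_one r with rfl | rfl <;>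
    simp [selectIndices, hA, hB, h3, h4, h5]

/-- The encoder of `C_{f,g}` as a linear map in `((u, r), v)`. -/
def codeMap (f g : (Fin m → ZMod 2) → ZMod 2) :
    ((ZMod 2 × ZMod 2) × (Fin m → ZMod 2)) →ₗ[ZMod 2] (NonzeroVec m → ZMod 2) where
  toFun p x := p.1.1 * f x.1 + p.1.2 * g x.1 + dotProduct p.2 x.1
  map_add' p p' := by
    ext x
    simp only [Prod.fst_add, Prod.snd_add, Pi.add_apply, add_dotProduct]
    ring
  map_smul' a p := by
    ext x
    simp only [Prod.smul_fst, Prod.smul_snd, Pi.smul_apply, smul_eq_mul, smul_dotProduct,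
      RingHom.id_apply]
    ring

lemma range_codeMap (f g : (Fin m → ZMod 2) → ZMod 2) :
    LinearMap.range (codeMap f g) = codeOf f g := by
  ext c
  constructor
  · rintro ⟨⟨⟨u, r⟩, v⟩, rfl⟩
    exact ⟨u, r, v, rfl⟩
  · rintro ⟨u, r, v, rfl⟩
    exact ⟨⟨⟨u, r⟩, v⟩, rfl⟩

lemma codeMap_spreadFunction (A B : Finset (Fin α))
    (p : (ZMod 2 × ZMod 2) × (Fin m → ZMod 2)) :
    codeMap (spreadFunction E A) (spreadFunction E B) p =
      spreadWord E (selectIndices A B p.1) p.2 := by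
  ext x
  rw [spreadWord, spreadFunction_selectIndices]
  rfl

end Spread

/-! ### Weight tables and a weight criterion for minimality -/

/-- Writing rows as indicators lets coinciding weights add up without case distinctions. -/
lemma sum_map_snd_filter_fst (T : List (ℕ × ℕ)) (w : ℕ) :
    ((T.filter fun row => row.1 = w).map Prod.snd).sum =
      (T.map fun row => row.2 * if row.1 = w then 1 else 0).sum := by
  induction T with
  | nil => rfl
  | cons a T ih => by_cases h : a.1 = w <;> simp [h, ih]

lemma weightCount_range_of_injective {K ι P : Type*} [Field K] [DecidableEq K] [Fintype ι]
    [AddCommGroup P] [Module K P] [Fintype P] {φ : P →ₗ[K] (ι → K)}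
    (hφ : Function.Injective φ) (w : ℕ) :
    weightCount (LinearMap.range φ) w =
      (Finset.univ.filter fun p => hammingNorm (φ p) = w).card := by
  have h : {c : ι → K | c ∈ LinearMap.range φ ∧ hammingNorm c = w} =
      φ '' {p | hammingNorm (φ p) = w} := by
    ext c
    constructor
    · rintro ⟨⟨p, rfl⟩, hp⟩
      exact ⟨p, hp, rfl⟩
    · rintro ⟨p, hp, rfl⟩
      exact ⟨⟨p, rfl⟩, hp⟩
  rw [weightCount, h, Set.ncard_image_of_injective _ hφ, ← Set.ncard_coe_finset]
  simp

lemma hammingNorm_add_of_support_subset {ι : Type*} [Fintype ι] {c c' : ι → ZMod 2}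
    (h : Function.support c' ⊆ Function.support c) :
    hammingNorm c = hammingNorm c' + hammingNorm (c + c') := by
  classical
  unfold hammingNorm
  rw [← Finset.card_union_of_disjoint]
  · congr 1
    ext x
    have hx := @h x
    simp only [Function.mem_support] at hx
    simp only [Finset.mem_filter, Finset.mem_univ, true_and, Finset.mem_union, Pi.add_apply]
    rcases ZMod.eq_zero_or_eq_one (c x) with h1 | h1 <;>
      rcases ZMod.eq_zero_or_eq_one (c' x) with h2 | h2 <;> simp_all [CharTwo.add_self_eq_zero]
  · refine Finset.disjoint_left.2 fun x h1 h2 => ?_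
    have hx := @h x
    simp only [Function.mem_support] at hx
    simp only [Finset.mem_filter, Finset.mem_univ, true_and, Pi.add_apply] at h1 h2
    rcases ZMod.eq_zero_or_eq_one (c x) with h1 | h1 <;>
      rcases ZMod.eq_zero_or_eq_one (c' x) with h2 | h2 <;> simp_all [CharTwo.add_self_eq_zero]

/-- A covered word `c'` splits `c` into `c'` and `c + c'` with disjoint supports, so weights would
add. -/
lemma isMinimalCode_range_of_hammingNorm_ne {ι P : Type*} [Fintype ι] [AddCommGroup P]
    [Module (ZMod 2) P] (φ : P →ₗ[ZMod 2] (ι → ZMod 2))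
    (h : ∀ p p', p ≠ 0 → p' ≠ 0 → p + p' ≠ 0 →
      hammingNorm (φ p) ≠ hammingNorm (φ p') + hammingNorm (φ (p + p'))) :
    IsMinimalCode (LinearMap.range φ) := by
  rintro _ ⟨p, rfl⟩ hp
  refine ⟨⟨p, rfl⟩, ?_⟩
  rintro _ ⟨p', rfl⟩ hp' hsub
  refine ⟨1, one_ne_zero, ?_⟩
  rw [one_smul]
  by_contra hne
  refine h p p' (fun h0 => hp (by rw [h0, map_zero])) (fun h0 => hp' (by rw [h0, map_zero]))
    (fun h0 => hne ?_) ?_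
  · have h1 : φ p + φ p' = 0 := by rw [← map_add, h0, map_zero]
    ext x
    exact (CharTwo.add_eq_zero.1 (congrFun h1 x)).symm
  · rw [map_add]
    exact hammingNorm_add_of_support_subset hsub

lemma sum_univ_zmod_two {M : Type*} [AddCommMonoid M] (f : ZMod 2 → M) :
    ∑ a, f a = f 0 + f 1 := Fin.sum_univ_two f

lemma exists_isLeast_isGreatest_nonzeroWeights {K ι : Type*} [Field K] [DecidableEq K]
    [Fintype ι] (C : Submodule K (ι → K)) (h : (nonzeroWeights C).Nonempty) :
    ∃ a b, IsLeast (nonzeroWeights C) a ∧ IsGreatest (nonzeroWeights C) b := by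
  have hb : BddAbove (nonzeroWeights C) := by
    refine ⟨Fintype.card ι, ?_⟩
    rintro _ ⟨c, _, _, rfl⟩
    exact hammingNorm_le_card_fintype
  exact ⟨sInf _, sSup _, ⟨Nat.sInf_mem h, fun _ hx => Nat.sInf_le hx⟩,
    ⟨Nat.sSup_mem h hb, fun _ hx => le_csSup hb hx⟩⟩

/-! ### Weight bounds and the main theorem -/

section Spread

variable {m α t s : ℕ} {E : Fin α → Submodule (ZMod 2) (Fin m → ZMod 2)}
  {A B : Finset (Fin α)}

lemma card_selectIndices_bounds (hA : A.card = s) (hB : B.card = s) (hAB : (A ∩ B).card = 1)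
    (hs2 : 2 ≤ s) {d : ZMod 2 × ZMod 2} (hd : d ≠ 0) :
    s ≤ (selectIndices A B d).card ∧ (selectIndices A B d).card ≤ 2 * s - 2 := by
  have hd' : d ≠ (0, 0) := hd
  rw [card_selectIndices hA hB hAB, if_neg hd']
  split_ifs <;> omega

lemma IsPartialSpread.hammingNorm_codeMap_zero (hE : IsPartialSpread t E) (hm : 1 ≤ m)
    (d : ZMod 2 × ZMod 2) :
    hammingNorm (codeMap (spreadFunction E A) (spreadFunction E B) (d, 0)) =
      (selectIndices A B d).card * (2 ^ t - 1) := by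
  rw [codeMap_spreadFunction, hE.hammingNorm_spreadWord_zero hm]

/-- For `d ≠ 0` the bounds come from `N = 0`, `|D| ≤ 2s - 2` and from `N = 1`, `|D| ≥ s`. For `d =
0` the weight is `2^(m-1)`, and `s ≤ 2^t` puts it below the upper bound. -/
lemma IsPartialSpread.hammingNorm_codeMap_bounds (hE : IsPartialSpread t E) (hm : 1 ≤ m)
    (hA : A.card = s) (hB : B.card = s) (hAB : (A ∩ B).card = 1) (hs2 : 2 ≤ s)
    (hsq : s ≤ 2 ^ t) (hsM : 2 * s ≤ 2 ^ (m - 1)) (d : ZMod 2 × ZMod 2)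
    {v : Fin m → ZMod 2} (hv : v ≠ 0) :
    2 ^ (m - 1) + 2 ≤
      hammingNorm (codeMap (spreadFunction E A) (spreadFunction E B) (d, v)) + 2 * s ∧
    hammingNorm (codeMap (spreadFunction E A) (spreadFunction E B) (d, v)) + s ≤
      2 ^ (m - 1) + 2 ^ t := by
  rw [codeMap_spreadFunction]
  rcases eq_or_ne d 0 with rfl | hd
  · have h0 : selectIndices A B 0 = ∅ := by
      rw [← Finset.card_eq_zero, card_selectIndices hA hB hAB]; rfl
    have h1 : perpCount E ∅ v = 0 := by simp [perpCount]
    rw [h0, hE.hammingNorm_spreadWord_of_perpCount_eq_zero hm hv h1, Finset.card_empty]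
    omega
  · obtain ⟨h1, h2⟩ := card_selectIndices_bounds hA hB hAB hs2 hd
    rcases Nat.le_one_iff_eq_zero_or_eq_one.1
      (hE.perpCount_le_one (selectIndices A B d) hv) with h | h
    · rw [hE.hammingNorm_spreadWord_of_perpCount_eq_zero hm hv h]
      omega
    · rw [hE.hammingNorm_spreadWord_of_perpCount_eq_one hm hv h]
      omega

end Spread

theorem theorem3 (m t α s : ℕ) (hm : m = 2 * t) (hm6 : 6 ≤ m)
    (E : Fin α → Submodule (ZMod 2) (Fin m → ZMod 2)) (hE : IsPartialSpread t E)
    (A B : Finset (Fin α)) (hA : A.card = s) (hB : B.card = s) (hAB : (A ∩ B).card = 1)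
    (hs2 : 2 ≤ s) (hs : s ≤ 2 ^ (t - 1) - 1) :
    IsLinearCode (codeOf (spreadFunction E A) (spreadFunction E B)) (2 ^ m - 1) (m + 2) ∧
    IsMinimalCode (codeOf (spreadFunction E A) (spreadFunction E B)) ∧
    HasWeightTable (codeOf (spreadFunction E A) (spreadFunction E B))
      [(0, 1),
       (s * (2 ^ t - 1), 2),
       ((2 * s - 2) * (2 ^ t - 1), 1),
       (2 ^ (m - 1), 2 ^ m - 1),
       (2 ^ (m - 1) - s, 2 * (2 ^ t + 1 - s) * (2 ^ t - 1)),
       (2 ^ (m - 1) - (2 * s - 2), (2 ^ t + 1 - (2 * s - 2)) * (2 ^ t - 1)),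
       (2 ^ (m - 1) + 2 ^ t - s, 2 * s * (2 ^ t - 1)),
       (2 ^ (m - 1) + 2 ^ t - (2 * s - 2), (2 * s - 2) * (2 ^ t - 1))] ∧
    (s ≤ 2 ^ (t - 2) →
      ∃ wmin wmax : ℕ,
        IsLeast (nonzeroWeights (codeOf (spreadFunction E A) (spreadFunction E B))) wmin ∧
        IsGreatest (nonzeroWeights (codeOf (spreadFunction E A) (spreadFunction E B))) wmax ∧
        (wmin : ℚ) / (wmax : ℚ) ≤ 1 / 2) := by
  classical
  have hm1 : 1 ≤ m := by omega
  have hq8 : 8 ≤ 2 ^ t := by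
    calc 8 = 2 ^ 3 := by norm_num
      _ ≤ 2 ^ t := Nat.pow_le_pow_right (by norm_num) (by omega)
  have hqs : 2 * s + 2 ≤ 2 ^ t := by
    have : 2 ^ t = 2 * 2 ^ (t - 1) := by rw [← pow_succ']; congr 1; omega
    have := Nat.one_le_two_pow (n := t - 1)
    omega
  have hmq : 2 ^ m = 2 ^ t * 2 ^ t := hE.two_pow_eq
  have hM : 2 * 2 ^ (m - 1) = 2 ^ t * 2 ^ t := by
    rw [← hmq, ← pow_succ']; congr 1; omega
  have hM8 : 8 * 2 ^ t ≤ 2 * 2 ^ (m - 1) := by rw [hM]; gcongr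
  have hM8' : 4 ≤ 2 ^ (m - 1) := by omega
  -- Two words with `v ≠ 0` together outweigh any word with `v = 0`.
  have hbig : (2 * s - 2) * (2 ^ t - 1) + 4 * s < 2 * 2 ^ (m - 1) + 4 := by
    rw [hM]
    generalize 2 ^ t = q at *
    zify [show 2 ≤ 2 * s by omega, show 1 ≤ q by omega]
    nlinarith
  -- A nonzero word with `v = 0` and a word with `v ≠ 0` together outweigh any word with `v ≠ 0`.
  have hsmall : 2 ^ t + s < s * (2 ^ t - 1) + 2 := by
    generalize 2 ^ t = q at *
    zify [show 1 ≤ q by omega]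
    nlinarith
  have hnorm0 := fun d => hE.hammingNorm_codeMap_zero (A := A) (B := B) hm1 d
  have hnorm := fun d v (hv : v ≠ 0) =>
    hE.hammingNorm_codeMap_bounds hm1 hA hB hAB hs2 (by omega) (by omega) d hv
  have hcard := fun d (hd : d ≠ 0) => card_selectIndices_bounds hA hB hAB hs2 (d := d) hd
  have hcard00 := card_selectIndices hA hB hAB
  rw [← range_codeMap]
  set φ := codeMap (spreadFunction E A) (spreadFunction E B) with hφdef
  -- Every nonzero argument is encoded with positive weight.
  have hφ : Function.Injective φ := by
    rw [← LinearMap.ker_eq_bot, LinearMap.ker_eq_bot']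
    rintro ⟨d, v⟩ h
    rw [← hammingNorm_eq_zero] at h
    rcases eq_or_ne v 0 with rfl | hv
    · rcases eq_or_ne d 0 with rfl | hd
      · rfl
      · rw [hnorm0] at h
        have h1 := (hcard d hd).1
        rcases Nat.mul_eq_zero.1 h with h | h <;> omega
    · have := (hnorm d v hv).1
      omega
  refine ⟨⟨?_, ?_⟩, ?_, ?_, ?_⟩
  · rw [Fintype.card_subtype_compl, Fintype.card_subtype_eq]
    simp
  · rw [LinearMap.finrank_range_of_inj hφ]
    simp [Module.finrank_prod, add_comm]
  · apply isMinimalCode_range_of_hammingNorm_ne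
    rintro ⟨d, v⟩ ⟨d', v'⟩ hp hp' hpp heq
    rw [Prod.mk_add_mk] at hpp heq
    have hlow : ∀ d, (d, (0 : Fin m → ZMod 2)) ≠ 0 → s * (2 ^ t - 1) ≤ hammingNorm (φ (d, 0)) := by
      intro d hd
      rw [hnorm0]
      exact Nat.mul_le_mul_right _ (hcard d (fun h => hd (by rw [h]; rfl))).1
    rcases eq_or_ne v 0 with rfl | hv
    · have hd : d ≠ 0 := fun h => hp (by rw [h]; rfl)
      have hup : hammingNorm (φ (d, 0)) ≤ (2 * s - 2) * (2 ^ t - 1) := by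
        rw [hnorm0]
        exact Nat.mul_le_mul_right _ (hcard d hd).2
      rw [zero_add] at heq hpp
      rcases eq_or_ne v' 0 with rfl | hv'
      · have h1 := hlow _ hp'
        have h2 := hlow _ hpp
        have h3 : (2 * s - 2) * (2 ^ t - 1) < s * (2 ^ t - 1) + s * (2 ^ t - 1) := by
          rw [← add_mul]
          exact Nat.mul_lt_mul_of_pos_right (by omega) (by omega)
        omega
      · have h1 := hnorm d' v' hv'
        have h2 := hnorm (d + d') v' hv'
        omega
    · have h1 := hnorm d v hv
      rcases eq_or_ne v' 0 with rfl | hv'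
      · rw [add_zero] at heq
        have h2 := hnorm (d + d') v hv
        have h3 := hlow _ hp'
        omega
      · have h2 := hnorm d' v' hv'
        rcases eq_or_ne (v + v') 0 with h0 | h0
        · rw [h0] at heq hpp
          have h3 := hlow _ hpp
          omega
        -- Twice the lower bound exceeds the upper one, as `2^(m-1) ≥ 4 · 2^t`.
        · have h3 := hnorm (d + d') _ h0
          omega
  · intro w
    rw [weightCount_range_of_injective hφ, sum_map_snd_filter_fst, Finset.card_filter,
      Fintype.sum_prod_type]
    have hle : ∀ d, (selectIndices A B d).card ≤ 2 ^ t + 1 := fun d => by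
      rw [hcard00]
      split_ifs <;> omega
    simp_rw [hφdef, codeMap_spreadFunction]
    rw [Finset.sum_congr rfl fun d _ => (Finset.card_filter _ _).symm.trans
      (hE.card_hammingNorm_spreadWord_eq hm1 (selectIndices A B d) (hle d) w)]
    simp only [hcard00, Fintype.sum_prod_type, sum_univ_zmod_two]
    -- The multiplicity of `2^(m-1)` contributed by `D = ∅`.
    have e : (2 ^ t + 1) * (2 ^ t - 1) = 2 ^ m - 1 := by
      rw [hmq, ← Nat.sq_sub_sq (2 ^ t) 1, sq, one_pow]
    simp only [List.map_cons, List.map_nil, List.sum_cons, List.sum_nil, if_true, Prod.mk.injEq,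
      one_ne_zero, zero_ne_one, and_false, if_false, Nat.sub_zero, zero_mul, e, and_true]
    ring
  · intro hs4
    obtain ⟨wmin, wmax, hmin, hmax⟩ :=
      exists_isLeast_isGreatest_nonzeroWeights (LinearMap.range φ)
        ⟨_, φ ((1, 0), 0), ⟨_, rfl⟩, by
          rw [Ne, map_eq_zero_iff φ hφ]; simp, rfl⟩
    refine ⟨wmin, wmax, hmin, hmax, ?_⟩
    -- One-sided bounds suffice: the word of `f` bounds `wmin`, a nonzero linear word bounds `wmax`.
    have h1 : wmin ≤ s * (2 ^ t - 1) := by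
      refine hmin.2 ⟨φ ((1, 0), 0), ⟨_, rfl⟩, ?_, ?_⟩
      · rw [Ne, map_eq_zero_iff φ hφ]; simp
      · rw [hnorm0, hcard00]; simp
    have h2 : 2 ^ (m - 1) ≤ wmax := by
      have hv : (fun _ => 1 : Fin m → ZMod 2) ≠ 0 := fun h => one_ne_zero (congrFun h ⟨0, hm1⟩)
      refine hmax.2 ⟨φ ((0, 0), fun _ => 1), ⟨_, rfl⟩, ?_, ?_⟩
      · rw [Ne, map_eq_zero_iff φ hφ, Prod.mk_eq_zero]
        exact fun h => hv h.2
      · have h0 : selectIndices A B (0, 0) = ∅ := by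
          rw [← Finset.card_eq_zero, hcard00]; rfl
        rw [hφdef, codeMap_spreadFunction]
        simp only [h0]
        rw [hE.hammingNorm_spreadWord_of_perpCount_eq_zero hm1 hv (by simp [perpCount]),
          Finset.card_empty, Nat.sub_zero]
    have h3 : 2 * (s * (2 ^ t - 1)) ≤ 2 ^ (m - 1) := by
      have h4 : 2 ^ t = 4 * 2 ^ (t - 2) := by
        rw [show (4 : ℕ) = 2 ^ 2 by norm_num, ← pow_add]; congr 1; omega
      have h5 : 4 * s ≤ 2 ^ t := by omega
      have h6 : 4 * s * (2 ^ t - 1) ≤ 2 ^ t * 2 ^ t := Nat.mul_le_mul h5 (by omega)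
      rw [mul_assoc] at h6
      omega
    have h4 : (0 : ℚ) < wmax := by exact_mod_cast (by omega : 0 < wmax)
    rw [div_le_div_iff₀ h4 two_pos]
    exact_mod_cast (by omega : wmin * 2 ≤ 1 * wmax)
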